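/- **Conventions.** For $b\ge 2$ every $n>0$ is written uniquely as $n=b^ea+r$ with $b^e\le n<b^{e+1}$, $0<a<b$ and $r<b^e$; this is the $b$-decomposition of $n$, written $n=_b b^ea+r$. A *base hierarchy* is a non-empty set $B\subseteq\mathbb N\setminus\{0,1\}$ such that $b\mid S_B(b)$ for every $b\in B$, where for $n\in\mathbb N$, $S_B(n)$ is the least $b\in B$ with $b>n$, and $S_B(n)=\infty$ if there is none; every natural number is less than $\infty$ and every positive integer divides $\infty$. For $n\in\mathbb N$ let $\mathrm{base}_B(n)=\max\{b\in B: b\le n\}$ if $n\ge\min B$, and $\mathrm{base}_B(n)=\min B$ otherwise. **Upgrade.** Let $B,C$ be base hierarchies with $\min B\le\min C$. The upgrade ${\uparrow}n={\uparrow}_B^Cn\in\mathbb N\cup\{\infty\}$ is defined by recursion on $n$. If $n<\min B$, then ${\uparrow}n=n$. Otherwise let $b=\mathrm{base}_B(n)$. For $c\in C$ define an operator $[b\to c]$ on the numbers $m\le n$ by $[b\to c]m={\uparrow}m$ if $m<b$, and $$[b\to c]m=c^{[b\to c]e}\cdot{\uparrow}a+[b\to c]r\qquad\text{if } m\ge b,\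 m=_b b^ea+r .$$ Then ${\uparrow}n=[b\to c]n$, where $c$ is the least element of $C$ such that ${\uparrow}(n-1)<[b\to c]n<S_C(c)$; if there is no such $c$, then ${\uparrow}n=\infty$. **Dynamical hierarchies.** For base hierarchies $B$ and $C$, $C$ is a *good successor* of $B$ if (1) $\min B\le\min C$; (2) ${\uparrow}_B^Cn<\infty$ for every $n\in\mathbb N$; (3) for every $b\in B$ with $b>\min B$, writing $x={\uparrow}_B^C(b-1)$, no multiple of $\mathrm{base}_C(x)$ lies strictly between $x$ and $S_C(x)$. A *dynamical hierarchy* is a sequence $\mathcal B=(B_i)_{i\in\mathbb N}$ of base hierarchies such that $B_{i+1}$ is a good successor of $B_i$ for every $i$. For $m\in\mathbb N$, its *multi-base Goodstein sequence* starting at $m$ is given by $\mathbb G_0^{\mathcal B}(m)=m$ and $$\mathbb G_{i+1}^{\mathcal B}(m)=\begin{cases}{\uparrow}_{B_i}^{B_{i+1}}\,\mathbb G_i^{\mathcal B}(m)-1 & \text{if } \mathbb G_i^{\mathcal B}(m)>0,\\ 0 & \text{otherwise.}\end{cases}$$ **Theorem.** For every dynamical hierarchy $\mathcal B$ and every $m\in\mathbb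 N$ there is $i\in\mathbb N$ such that $\mathbb G_i^{\mathcal B}(m)=0$. -/

import Mathlib

namespace FractalGoodstein

/-- `baseAt B n`: the greatest element of `B` that is at most `n`,
and `min B` if `n < min B`. -/
noncomputable def baseAt (B : Set ℕ) (n : ℕ) : ℕ :=
  if sInf B ≤ n then sSup {b | b ∈ B ∧ b ≤ n} else sInf B

/-- `nextBase B n`: the least element of `B` that is greater than `n`,
and `∞` if there is none. -/
noncomputable def nextBase (B : Set ℕ) (n : ℕ) : ℕ∞ :=
  sInf ((fun b : ℕ => (b : ℕ∞)) '' {b | b ∈ B ∧ n < b})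

/-- A base hierarchy: a non-empty set of natural numbers `≥ 2` in which every element divides
its successor. Every positive integer divides `∞`, so a greatest element is unconstrained. -/
structure IsBaseHierarchy (B : Set ℕ) : Prop where
  two_le : ∀ b ∈ B, 2 ≤ b
  nonempty : B.Nonempty
  dvd_nextBase : ∀ b ∈ B, (b : ℕ∞) ∣ nextBase B b

/-- The exponent `e` of the `b`-decomposition `n = b ^ e * a + r`. -/
def decExp (b n : ℕ) : ℕ := Nat.log b n

/-- The coefficient `a` of the `b`-decomposition `n = b ^ e * a + r`. -/
def decCoeff (b n : ℕ) : ℕ := n / b ^ decExp b n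

/-- The remainder `r` of the `b`-decomposition `n = b ^ e * a + r`. -/
def decRem (b n : ℕ) : ℕ := n % b ^ decExp b n

/-- For `b ≥ 2` and `n > 0`, the triple `(decExp b n, decCoeff b n, decRem b n)` is the only one
with the properties of the `b`-decomposition. -/
theorem dec_iff {b n : ℕ} (hb : 2 ≤ b) (hn : 0 < n) (e a r : ℕ) :
    (n = b ^ e * a + r ∧ b ^ e ≤ n ∧ n < b ^ (e + 1) ∧ 0 < a ∧ a < b ∧ r < b ^ e) ↔
      (e = decExp b n ∧ a = decCoeff b n ∧ r = decRem b n) := by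
  constructor
  · rintro ⟨h, h1, h2, -, -, h5⟩
    have he : e = decExp b n := ((Nat.log_eq_iff (Or.inr ⟨hb, hn.ne'⟩)).2 ⟨h1, h2⟩).symm
    refine ⟨he, ?_, ?_⟩
    · rw [decCoeff, ← he, h, Nat.mul_add_div (by positivity), Nat.div_eq_of_lt h5, add_zero]
    · rw [decRem, ← he, h, Nat.mul_add_mod, Nat.mod_eq_of_lt h5]
  · rintro ⟨rfl, rfl, rfl⟩
    have h1 : b ^ decExp b n ≤ n := Nat.pow_log_le_self b hn.ne'
    have h2 : n < b ^ (decExp b n + 1) := Nat.lt_pow_succ_log_self hb n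
    have h0 : 0 < b ^ decExp b n := by positivity
    refine ⟨(Nat.div_add_mod _ _).symm, h1, h2, Nat.div_pos h1 h0, ?_, Nat.mod_lt _ h0⟩
    rw [decCoeff, Nat.div_lt_iff_lt_mul h0, mul_comm, ← pow_succ]
    exact h2

theorem decExp_lt {b n : ℕ} (hb : 2 ≤ b) (h : b ≤ n) : decExp b n < n :=
  Nat.log_lt_self b (show n ≠ 0 by omega)

theorem decCoeff_lt {b n : ℕ} (hb : 2 ≤ b) (h : b ≤ n) : decCoeff b n < b :=
  ((dec_iff hb (show 0 < n by omega) _ _ _).2 ⟨rfl, rfl, rfl⟩).2.2.2.2.1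

theorem decRem_lt {b n : ℕ} (hb : 2 ≤ b) (h : b ≤ n) : decRem b n < n := by
  obtain ⟨-, h1, -, -, -, h2⟩ := (dec_iff hb (show 0 < n by omega) _ _ _).2 ⟨rfl, rfl, rfl⟩
  exact h2.trans_le h1

/-- The base change from `b` to `c` in which the coefficients are replaced through `f`:
`m` is sent to `f m` if `m < b`, and `m = b ^ e * a + r` (the `b`-decomposition) is sent to
`c ^ e' * f a + r'`, where `e'` and `r'` are the images of `e` and `r`, if `m ≥ b`.
Only bases `b ≥ 2` are used. -/
noncomputable def changeBase (b c : ℕ) (f : ℕ → ℕ∞) (m : ℕ) : ℕ∞ :=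
  if _h : 2 ≤ b ∧ b ≤ m then
    (c : ℕ∞) ^ changeBase b c f (decExp b m) * f (decCoeff b m) + changeBase b c f (decRem b m)
  else f m
termination_by m
decreasing_by
  · exact decExp_lt _h.1 _h.2
  · exact decRem_lt _h.1 _h.2

/-- The upgrade `↑n` of `n` from `B` to `C`, by recursion on `n`. If `n < min B`, then `↑n = n`.
Otherwise let `b = baseAt B n`. If there is some `c ∈ C` such that the base change from `b` to `c`,
with the upgrade applied to the coefficients, sends `n` to a number strictly between `↑(n - 1)` and
`nextBase C c`, then `↑n` is the value obtained from the least such `c`; if not, `↑n = ∞`.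
In the body, `up` is the upgrade on the numbers below `n`; its value `0` from `n` onwards
is never used, see `upgrade_of_lt` and `upgrade_of_le`. -/
noncomputable def upgrade (B C : Set ℕ) (n : ℕ) : ℕ∞ :=
  open Classical in
  if n < sInf B then (n : ℕ∞)
  else
    let up : ℕ → ℕ∞ := fun m => if _h : m < n then upgrade B C m else 0
    let b := baseAt B n
    let W : Set ℕ := {c | c ∈ C ∧ up (n - 1) < changeBase b c up n ∧
      changeBase b c up n < nextBase C c}
    if W.Nonempty then changeBase b (sInf W) up n else ⊤
termination_by n

/-- The numbers `c ∈ C` among which the witness for the upgrade of `n` is the least one. -/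
def witnesses (B C : Set ℕ) (n : ℕ) : Set ℕ :=
  {c | c ∈ C ∧ upgrade B C (n - 1) < changeBase (baseAt B n) c (upgrade B C) n ∧
    changeBase (baseAt B n) c (upgrade B C) n < nextBase C c}

theorem changeBase_congr {b : ℕ} (hb : 2 ≤ b) (c : ℕ) {f g : ℕ → ℕ∞} (h : ∀ a < b, f a = g a)
    (m : ℕ) : changeBase b c f m = changeBase b c g m := by
  induction m using Nat.strong_induction_on with
  | _ m ih =>
    rw [changeBase.eq_1 b c f, changeBase.eq_1 b c g]
    by_cases hm : b ≤ m
    · rw [dif_pos ⟨hb, hm⟩, dif_pos ⟨hb, hm⟩, ih _ (decExp_lt hb hm), ih _ (decRem_lt hb hm),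
        h _ (decCoeff_lt hb hm)]
    · rw [dif_neg (by tauto), dif_neg (by tauto), h m (by omega)]

theorem baseAt_spec {B : Set ℕ} (hB : B.Nonempty) {n : ℕ} (hn : sInf B ≤ n) :
    baseAt B n ∈ B ∧ baseAt B n ≤ n ∧ ∀ b ∈ B, b ≤ n → b ≤ baseAt B n := by
  have hbdd : BddAbove {b | b ∈ B ∧ b ≤ n} := ⟨n, fun _ hb => hb.2⟩
  have hmem : sSup {b | b ∈ B ∧ b ≤ n} ∈ {b | b ∈ B ∧ b ≤ n} :=
    Nat.sSup_mem ⟨sInf B, Nat.sInf_mem hB, hn⟩ hbdd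
  rw [baseAt, if_pos hn]
  exact ⟨hmem.1, hmem.2, fun b hb hbn => le_csSup hbdd ⟨hb, hbn⟩⟩

theorem upgrade_of_lt (B C : Set ℕ) {n : ℕ} (hn : n < sInf B) : upgrade B C n = n := by
  rw [upgrade, if_pos hn]

open Classical in
theorem upgrade_of_le {B : Set ℕ} (hB : IsBaseHierarchy B) (C : Set ℕ) {n : ℕ} (hn : sInf B ≤ n) :
    upgrade B C n = if (witnesses B C n).Nonempty then
      changeBase (baseAt B n) (sInf (witnesses B C n)) (upgrade B C) n else ⊤ := by
  obtain ⟨h1, h2, -⟩ := baseAt_spec hB.nonempty hn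
  have h3 : 2 ≤ baseAt B n := hB.two_le _ h1
  have hc : ∀ c, changeBase (baseAt B n) c
      (fun m => if _h : m < n then upgrade B C m else 0) n =
      changeBase (baseAt B n) c (upgrade B C) n := fun c =>
    changeBase_congr h3 c (fun a ha => by rw [dif_pos (by omega)]) n
  rw [upgrade, if_neg (by omega)]
  simp only [hc, dif_pos (show n - 1 < n by omega)]
  rfl

/-- `C` is a good successor of `B`: the minimum does not decrease, all upgrades from `B` to `C` are
finite, and for every `b ∈ B` other than `min B`, with `x` the upgrade of `b - 1`, no multiple of
`baseAt C x` lies strictly between `x` and `nextBase C x`. -/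
structure IsGoodSuccessor (B C : Set ℕ) : Prop where
  min_le : sInf B ≤ sInf C
  upgrade_lt_top : ∀ n, upgrade B C n < ⊤
  no_multiple : ∀ b ∈ B, sInf B < b → ∀ x : ℕ, upgrade B C (b - 1) = x →
    ¬ ∃ k : ℕ, baseAt C x ∣ k ∧ x < k ∧ (k : ℕ∞) < nextBase C x

/-- A dynamical hierarchy: a sequence of base hierarchies, each of which is a good successor of
the previous one. -/
structure DynamicalHierarchy where
  base : ℕ → Set ℕ
  isBaseHierarchy : ∀ i, IsBaseHierarchy (base i)
  isGoodSuccessor : ∀ i, IsGoodSuccessor (base i) (base (i + 1))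

/-- The upgrade at step `i` of a dynamical hierarchy, as a natural number. -/
noncomputable def DynamicalHierarchy.upgradeAt (H : DynamicalHierarchy) (i n : ℕ) : ℕ :=
  (upgrade (H.base i) (H.base (i + 1)) n).lift ((H.isGoodSuccessor i).upgrade_lt_top n)

/-- The multi-base Goodstein sequence of `H` starting at `m`. -/
noncomputable def goodstein (H : DynamicalHierarchy) (m : ℕ) : ℕ → ℕ
  | 0 => m
  | i + 1 => if 0 < goodstein H m i then H.upgradeAt i (goodstein H m i) - 1 else 0

end FractalGoodstein

/-!
The pair `(i, n)` stands for the number `n` at step `i`, and it is identified with `(i + 1, ↑n)`.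
Upgrades are strictly increasing, so this makes the pairs a linear order, the direct limit of the
steps, in which a nonzero Goodstein sequence strictly descends. Termination therefore follows if
the relation `Below`, which describes this order, is well-founded. Let `W` be its
accessible part, an initial segment.

For `n` with base `b` at step `i`, let the shape of `n` be the ordinal `[b → Ω] n`, in which the
coefficients are replaced by their ranks in `W`, and `Ω` is greater than all such ranks. If
`b - 1 ∈ W`, then all coefficients of `n` are in `W` as well, and so are all numbers below `b`. The
numbers from `b` to `n` have base `b` too, and so their shapes are below that of `n`
(`ordEval_strictMono`). Hence induction on the shape proves that `b - 1 ∈ W` implies `n ∈ W`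
(`acc_of_acc_baseAt_sub_one`), as soon as the two hypotheses pass from `n` to its upgrade
at the next step.

The shape does not increase, because a base change maps base `b` notation to base `c` notation
(`ordEval_natEval`). The base `c` of `↑n` is at least `↑b`. That `↑b - 1 ∈ W` is where the third
condition on good successors is used (`acc_upgradeAt_base_sub_one`): with `d` the base preceding
`↑b`, the numbers `↑(b - 1)` and `↑b - 1` differ in their last base `d` digit only, and `W` is
closed under such additions of a digit (`acc_add_digit`). If `c > ↑b`, let `c'` be a base
with `↑b < c' ≤ c`, and let `d` be the base preceding it. As `↑n` does not use `d`, the base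
change of `n` to `d` is at least `c'` (`IsUpgrade.le_natEval_of_skip`). So `c' - 1` has a smaller
shape than `n`, and the induction hypothesis gives `c' - 1 ∈ W` for one `c'` after the other.

Since `b - 1 < n`, an induction on `n` now shows that all pairs are in `W`.
-/

namespace FractalGoodstein

/-! ### Hereditary base decompositions -/

/-- The value of `m`, written hereditarily in base `b`, when the coefficients are interpreted
through `f` and `g e a r` interprets `b ^ e * a + r`. -/
def hereditary {α : Type*} (b : ℕ) (g : α → α → α → α) (f : ℕ → α) (m : ℕ) : α :=
  if _h : 2 ≤ b ∧ b ≤ m then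
    g (hereditary b g f (decExp b m)) (f (decCoeff b m)) (hereditary b g f (decRem b m))
  else f m
termination_by m
decreasing_by
  · exact decExp_lt _h.1 _h.2
  · exact decRem_lt _h.1 _h.2

/-- The base change from `b` to `c` with coefficients replaced through `u`, in `ℕ`. -/
def natEval (b c : ℕ) (u : ℕ → ℕ) : ℕ → ℕ :=
  hereditary b (fun e a r => c ^ e * a + r) u

/-- The base change from `b` to the ordinal `Ω` with coefficients replaced through `f`. -/
noncomputable def ordEval (b : ℕ) (Ω : Ordinal.{0}) (f : ℕ → Ordinal.{0}) : ℕ → Ordinal.{0} :=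
  hereditary b (fun e a r => Ω ^ e * a + r) f

section Hereditary

variable {α β : Type*} {b : ℕ}

theorem hereditary_of_lt (g : α → α → α → α) (f : ℕ → α) {m : ℕ} (h : m < b) :
    hereditary b g f m = f m := by
  rw [hereditary, dif_neg (by omega)]

theorem base_le_pow_mul_add {e a r : ℕ} (hb : 2 ≤ b) (he : 0 < e) (ha : 0 < a) :
    b ≤ b ^ e * a + r :=
  calc b = b ^ 1 * 1 := by simp
    _ ≤ b ^ e * a := Nat.mul_le_mul (Nat.pow_le_pow_right (by omega) he) ha
    _ ≤ _ := Nat.le_add_right _ _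

theorem pow_mul_add_lt {e a a' r : ℕ} (h : a < a') (hr : r < b ^ e) :
    b ^ e * a + r < b ^ e * a' :=
  calc b ^ e * a + r < b ^ e * (a + 1) := by rw [mul_add_one]; omega
    _ ≤ _ := Nat.mul_le_mul_left _ h

theorem hereditary_pow_mul_add (hb : 2 ≤ b) (g : α → α → α → α) (f : ℕ → α) {e a r : ℕ}
    (he : 0 < e) (ha : 0 < a) (hab : a < b) (hr : r < b ^ e) :
    hereditary b g f (b ^ e * a + r) = g (hereditary b g f e) (f a) (hereditary b g f r) := by
  have hle := base_le_pow_mul_add (r := r) hb he ha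
  obtain ⟨h1, h2, h3⟩ := (dec_iff hb (by omega : 0 < b ^ e * a + r) e a r).1
    ⟨rfl, (Nat.le_mul_of_pos_right _ ha).trans (Nat.le_add_right _ _),
      by rw [pow_succ]; exact pow_mul_add_lt hab hr, ha, hab, hr⟩
  rw [hereditary, dif_pos ⟨hb, hle⟩, ← h1, ← h2, ← h3]

/-- Induction along hereditary base `b` notation. -/
theorem hereditary_induction (hb : 2 ≤ b) {P : ℕ → Prop} (lt : ∀ m < b, P m)
    (step : ∀ e a r, 0 < e → 0 < a → a < b → r < b ^ e → P e → P r → P (b ^ e * a + r))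
    (m : ℕ) : P m := by
  induction m using Nat.strong_induction_on with
  | _ m ih =>
    rcases lt_or_ge m b with h | h
    · exact lt m h
    · obtain ⟨h0, -, -, h3, h4, h5⟩ := (dec_iff hb (show 0 < m by omega) _ _ _).2 ⟨rfl, rfl, rfl⟩
      rw [h0]
      exact step _ _ _ (Nat.log_pos hb h) h3 h4 h5 (ih _ (decExp_lt hb h)) (ih _ (decRem_lt hb h))

theorem map_hereditary (φ : α → β) {g : α → α → α → α} {g' : β → β → β → β}
    (h : ∀ e a r, φ (g e a r) = g' (φ e) (φ a) (φ r)) (hb : 2 ≤ b) (f : ℕ → α) (m : ℕ) :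
    φ (hereditary b g f m) = hereditary b g' (fun a => φ (f a)) m := by
  induction m using hereditary_induction hb with
  | lt m hm => rw [hereditary_of_lt _ _ hm, hereditary_of_lt _ _ hm]
  | step e a r he ha hab hr ihe ihr =>
    rw [hereditary_pow_mul_add hb _ _ he ha hab hr, hereditary_pow_mul_add hb _ _ he ha hab hr,
      h, ihe, ihr]

theorem changeBase_coe (hb : 2 ≤ b) (c : ℕ) (u : ℕ → ℕ) (m : ℕ) :
    changeBase b c (fun a => (u a : ℕ∞)) m = natEval b c u m := by
  rw [natEval, map_hereditary (fun k : ℕ => (k : ℕ∞))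
    (g' := fun e a r => (c : ℕ∞) ^ e * a + r) (fun e a r => by push_cast; simp) hb]
  induction m using Nat.strong_induction_on with
  | _ m ih =>
    rw [changeBase, hereditary]
    split_ifs with h
    · rw [ih _ (decExp_lt h.1 h.2), ih _ (decRem_lt h.1 h.2)]
    · rfl

theorem natCast_natEval (hb : 2 ≤ b) (c : ℕ) (u : ℕ → ℕ) (m : ℕ) :
    (natEval b c u m : Ordinal.{0}) = ordEval b c (fun a => (u a : Ordinal)) m :=
  map_hereditary (fun k : ℕ => (k : Ordinal.{0})) (fun e a r => by push_cast; simp) hb u m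

end Hereditary

section Monotone

variable {b : ℕ} {Ω : Ordinal.{0}} {f : ℕ → Ordinal.{0}}

theorem ordEval_of_lt {m : ℕ} (h : m < b) : ordEval b Ω f m = f m := hereditary_of_lt _ _ h

theorem ordEval_pow_mul_add (hb : 2 ≤ b) {e a r : ℕ}
    (he : 0 < e) (ha : 0 < a) (hab : a < b) (hr : r < b ^ e) :
    ordEval b Ω f (b ^ e * a + r) = Ω ^ ordEval b Ω f e * f a + ordEval b Ω f r :=
  hereditary_pow_mul_add hb _ _ he ha hab hr

/-- The base change to an ordinal `Ω` is strictly increasing if its coefficients are, and lie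
below `Ω`. -/
theorem ordEval_strictMono (hb : 2 ≤ b) (hf : ∀ a a', a < a' → a' < b → f a < f a')
    (hΩ : ∀ a < b, f a < Ω) : StrictMono (ordEval b Ω f) := by
  have hpos : ∀ a, 0 < a → a < b → 0 < f a := fun a h h' => zero_le.trans_lt (hf 0 a h h')
  have hΩ0 : 0 < Ω := zero_le.trans_lt (hΩ 0 (by omega))
  have key : ∀ (e a : ℕ) (x : Ordinal.{0}), x < Ω ^ ordEval b Ω f e → ∀ y, f a < y →
      Ω ^ ordEval b Ω f e * f a + x < Ω ^ ordEval b Ω f e * y := by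
    intro e a x hx y hy
    calc Ω ^ ordEval b Ω f e * f a + x < Ω ^ ordEval b Ω f e * f a + Ω ^ ordEval b Ω f e := by
          gcongr
      _ = Ω ^ ordEval b Ω f e * (f a + 1) := by rw [mul_add_one]
      _ ≤ _ := by gcongr; exact Order.add_one_le_of_lt hy
  suffices H : ∀ n, ∀ m < n, ordEval b Ω f m < ordEval b Ω f n from fun m n h => H n m h
  intro n
  induction n using Nat.strong_induction_on with
  | _ n ih =>
  intro m hm
  rcases lt_or_ge n b with hn | hn
  · rw [ordEval_of_lt hn, ordEval_of_lt (hm.trans hn)]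
    exact hf m n hm hn
  have small : ∀ k e, 0 < e → e < n → k < b ^ e → ordEval b Ω f k < Ω ^ ordEval b Ω f e := by
    intro k
    induction k using hereditary_induction hb with
    | lt k hk =>
      intro e he hen _
      rw [ordEval_of_lt hk]
      refine (hΩ k hk).trans_le ?_
      conv_lhs => rw [← Ordinal.opow_one Ω]
      exact Ordinal.opow_le_opow_right hΩ0
        (Order.one_le_iff_pos.2 (zero_le.trans_lt (ih e hen 0 he)))
    | step e' a' r' he' ha' hab' hr' _ ihr' =>
      intro e he hen hk
      have hee : e' < e := by
        by_contra! h
        have h1 := Nat.pow_le_pow_right (show 0 < b by omega) h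
        have h2 := Nat.le_mul_of_pos_right (b ^ e') ha'
        omega
      rw [ordEval_pow_mul_add hb he' ha' hab' hr']
      refine (key e' a' _ (ihr' e' he' (hee.trans hen) hr') Ω (hΩ a' hab')).trans_le ?_
      rw [← Ordinal.opow_succ]
      exact Ordinal.opow_le_opow_right hΩ0 (Order.succ_le_of_lt (ih e hen e' hee))
  obtain ⟨h0, h1, h2, h3, h4, h5⟩ := (dec_iff hb (show 0 < n by omega) _ _ _).2 ⟨rfl, rfl, rfl⟩
  have hen := decExp_lt hb hn
  have hrn := decRem_lt hb hn
  have he : 0 < decExp b n := Nat.log_pos hb hn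
  generalize decExp b n = e at *
  generalize decCoeff b n = a at *
  generalize decRem b n = r at *
  rw [h0, ordEval_pow_mul_add hb he h3 h4 h5]
  rcases lt_or_ge m (b ^ e) with hme | hme
  · refine (small m e he hen hme).trans_le ((Ordinal.le_mul_left _ (hpos a h3 h4)).trans ?_)
    exact le_self_add
  · -- `m` has the same exponent `e`, so the coefficients decide, and then the remainders
    obtain ⟨a', r', hr', rfl⟩ : ∃ a' r', r' < b ^ e ∧ m = b ^ e * a' + r' :=
      ⟨m / b ^ e, m % b ^ e, Nat.mod_lt _ (by positivity), (Nat.div_add_mod _ _).symm⟩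
    have ha' : 0 < a' := by
      rcases Nat.eq_zero_or_pos a' with rfl | h
      · simp at hme; omega
      · exact h
    have haa : a' ≤ a := by
      by_contra! h
      have := pow_mul_add_lt h h5
      omega
    rw [ordEval_pow_mul_add hb he ha' (by omega) hr']
    rcases haa.lt_or_eq with h | rfl
    · exact (key e a' _ (small r' e he hen hr') _ (hf a' a h h4)).trans_le le_self_add
    · have := ih r hrn r' (by omega)
      gcongr

/-- The base change to an ordinal is weakly increasing in the ordinal and in the values of the
coefficients. -/
theorem ordEval_mono (hb : 2 ≤ b) {Ω' : Ordinal.{0}} {f' : ℕ → Ordinal.{0}} (hΩ0 : 0 < Ω)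
    (hΩ : Ω ≤ Ω') (hf : ∀ a < b, f a ≤ f' a) (m : ℕ) : ordEval b Ω f m ≤ ordEval b Ω' f' m := by
  induction m using hereditary_induction hb with
  | lt m hm => rw [ordEval_of_lt hm, ordEval_of_lt hm]; exact hf m hm
  | step e a r he ha hab hr ihe ihr =>
    rw [ordEval_pow_mul_add hb he ha hab hr, ordEval_pow_mul_add hb he ha hab hr]
    gcongr
    · exact hΩ0.trans_le hΩ
    · exact hf a hab

end Monotone

section NatEval

variable {b c : ℕ} {u : ℕ → ℕ}

theorem natEval_of_lt {m : ℕ} (h : m < b) : natEval b c u m = u m := hereditary_of_lt _ _ h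

theorem natEval_pow_mul_add (hb : 2 ≤ b) {e a r : ℕ}
    (he : 0 < e) (ha : 0 < a) (hab : a < b) (hr : r < b ^ e) :
    natEval b c u (b ^ e * a + r) = c ^ natEval b c u e * u a + natEval b c u r :=
  hereditary_pow_mul_add hb _ _ he ha hab hr

theorem natEval_strictMono (hb : 2 ≤ b) (hu : StrictMono u) (hc : ∀ a < b, u a < c) :
    StrictMono (natEval b c u) := by
  intro m n h
  have := ordEval_strictMono hb (Ω := c) (f := fun a => (u a : Ordinal.{0}))
    (fun a a' h _ => by exact_mod_cast hu h) (fun a h => by exact_mod_cast hc a h) h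
  rw [← natCast_natEval hb, ← natCast_natEval hb] at this
  exact_mod_cast this

theorem natEval_mono_base (hb : 2 ≤ b) {c' : ℕ} (hc : 0 < c) (h : c ≤ c') (m : ℕ) :
    natEval b c u m ≤ natEval b c' u m := by
  have := ordEval_mono hb (Ω := c) (Ω' := c') (f := fun a => (u a : Ordinal.{0}))
    (by exact_mod_cast hc) (by exact_mod_cast h) (fun _ _ => le_rfl) m
  rw [← natCast_natEval hb, ← natCast_natEval hb] at this
  exact_mod_cast this

theorem natEval_lt_pow (hb : 2 ≤ b) (hu : StrictMono u) (hc : ∀ a < b, u a < c)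
    {e r : ℕ} (he : 0 < e) (hr : r < b ^ e) : natEval b c u r < c ^ natEval b c u e := by
  have hc0 : 0 < c := (Nat.zero_le _).trans_lt (hc 0 (by omega))
  have hmono := natEval_strictMono hb hu hc
  induction r using hereditary_induction hb generalizing e with
  | lt r h =>
    rw [natEval_of_lt h]
    have h1 : 0 < natEval b c u e := (Nat.zero_le _).trans_lt (hmono he)
    exact (hc r h).trans_le (Nat.le_self_pow h1.ne' c)
  | step e' a r he' ha hab hr' _ ihr =>
    have hee : e' < e := by
      by_contra! h
      have h1 := Nat.pow_le_pow_right (show 0 < b by omega) h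
      have h2 := Nat.le_mul_of_pos_right (b ^ e') ha
      omega
    rw [natEval_pow_mul_add hb he' ha hab hr']
    calc _ < c ^ natEval b c u e' * c := pow_mul_add_lt (hc a hab) (ihr he' hr')
      _ = c ^ (natEval b c u e' + 1) := (pow_succ _ _).symm
      _ ≤ _ := Nat.pow_le_pow_right hc0 (hmono hee)

/-- A base change from `b` to `c` turns hereditary base `b` notation into hereditary base `c`
notation, so that a further base change from `c` to `Ω` can be composed with it. -/
theorem ordEval_natEval (hb : 2 ≤ b) (hc2 : 2 ≤ c) (hu : StrictMono u) (hc : ∀ a < b, u a < c)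
    (Ω : Ordinal.{0}) (f : ℕ → Ordinal.{0}) (m : ℕ) :
    ordEval c Ω f (natEval b c u m) = ordEval b Ω (fun a => f (u a)) m := by
  induction m using hereditary_induction hb with
  | lt m h => rw [natEval_of_lt h, ordEval_of_lt h, ordEval_of_lt (hc m h)]
  | step e a r he ha hab hr ihe ihr =>
    rw [natEval_pow_mul_add hb he ha hab hr, ordEval_pow_mul_add hb he ha hab hr,
      ordEval_pow_mul_add hc2 ((Nat.zero_le _).trans_lt (natEval_strictMono hb hu hc he))
        ((Nat.zero_le _).trans_lt (hu ha)) (hc a hab) (natEval_lt_pow hb hu hc he hr), ihe, ihr]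

theorem base_le_natEval (hb : 2 ≤ b) (hc2 : 2 ≤ c) (hu : StrictMono u) (hc : ∀ a < b, u a < c)
    {m : ℕ} (hm : b ≤ m) : c ≤ natEval b c u m := by
  induction m using hereditary_induction hb with
  | lt m h => omega
  | step e a r he ha hab hr =>
    rw [natEval_pow_mul_add hb he ha hab hr]
    exact base_le_pow_mul_add hc2 ((Nat.zero_le _).trans_lt (natEval_strictMono hb hu hc he))
      ((Nat.zero_le _).trans_lt (hu ha))

/-- On multiples of `b`, a base change to `c` gives multiples of `c`, and it changes a last digit
`a` separately. -/
theorem natEval_add_digit (hb : 2 ≤ b) (hu : StrictMono u) (hu0 : u 0 = 0)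
    (hc : ∀ a < b, u a < c) {q : ℕ} (hq : b ∣ q) :
    c ∣ natEval b c u q ∧ ∀ a < b, natEval b c u (q + a) = natEval b c u q + u a := by
  induction q using hereditary_induction hb with
  | lt q h =>
    obtain rfl : q = 0 := Nat.eq_zero_of_dvd_of_lt hq h
    have h0 : natEval b c u 0 = 0 := by rw [natEval_of_lt h, hu0]
    exact ⟨by simp [h0], fun a ha => by rw [h0, zero_add, zero_add, natEval_of_lt ha]⟩
  | step e d r he hd hdb hr _ ihr =>
    have hbe : b ∣ b ^ e := dvd_pow_self b he.ne'
    have hbr : b ∣ r := (Nat.dvd_add_right (hbe.mul_right d)).1 hq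
    obtain ⟨h1, h2⟩ := ihr hbr
    rw [natEval_pow_mul_add hb he hd hdb hr]
    refine ⟨dvd_add ((dvd_pow_self c ((Nat.zero_le _).trans_lt
      (natEval_strictMono hb hu hc he)).ne').mul_right _) h1, fun a ha => ?_⟩
    have hra : r + a < b ^ e := by
      obtain ⟨x, hx⟩ := hbe
      obtain ⟨y, rfl⟩ := hbr
      rw [hx] at hr ⊢
      calc b * y + a < b * (y + 1) := by rw [mul_add_one]; omega
        _ ≤ b * x := Nat.mul_le_mul_left _ (Nat.lt_of_mul_lt_mul_left hr)
    rw [add_assoc, natEval_pow_mul_add hb he hd hdb hra, h2 a ha, add_assoc]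

end NatEval

/-! ### Base hierarchies and a single upgrade -/

section BaseHierarchy

variable {B : Set ℕ}

theorem natCast_lt_nextBase_iff {x c : ℕ} :
    (x : ℕ∞) < nextBase B c ↔ ∀ d ∈ B, c < d → x < d := by
  rw [← ENat.natCast_add_one_le_iff, nextBase, le_sInf_iff]
  simp only [Set.forall_mem_image, Set.mem_ofPred_eq, and_imp]
  refine forall₃_congr fun d _ _ => ?_
  exact_mod_cast Nat.succ_le_iff

theorem baseAt_eq {b n : ℕ} (hb : b ∈ B) (hbn : b ≤ n) (h : ∀ d ∈ B, d ≤ n → d ≤ b) :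
    baseAt B n = b := by
  obtain ⟨h1, h2, h3⟩ := baseAt_spec ⟨b, hb⟩ ((Nat.sInf_le hb).trans hbn)
  exact le_antisymm (h _ h1 h2) (h3 b hb hbn)

theorem baseAt_self {b : ℕ} (hb : b ∈ B) : baseAt B b = b :=
  baseAt_eq hb le_rfl fun _ _ h => h

theorem sInf_le_of_mem_of_le {b n : ℕ} (hb : b ∈ B) (h : b ≤ n) : sInf B ≤ n :=
  (Nat.sInf_le hb).trans h

theorem baseAt_mono {m n : ℕ} (hB : B.Nonempty) (hm : sInf B ≤ m) (h : m ≤ n) :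
    baseAt B m ≤ baseAt B n := by
  obtain ⟨h1, h2, -⟩ := baseAt_spec hB hm
  exact (baseAt_spec hB (hm.trans h)).2.2 _ h1 (h2.trans h)

theorem baseAt_eq_of_le {m n : ℕ} (hB : B.Nonempty) (hn : sInf B ≤ n) (h : baseAt B n ≤ m)
    (hmn : m ≤ n) : baseAt B m = baseAt B n := by
  obtain ⟨h1, h2, h3⟩ := baseAt_spec hB hn
  exact baseAt_eq h1 h fun d hd hdm => h3 d hd (hdm.trans hmn)

theorem IsBaseHierarchy.two_le_sInf (hB : IsBaseHierarchy B) : 2 ≤ sInf B :=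
  hB.two_le _ (Nat.sInf_mem hB.nonempty)

/-- An element of a base hierarchy divides the next one. -/
theorem IsBaseHierarchy.dvd_of_succ (hB : IsBaseHierarchy B) {b d : ℕ} (hb : b ∈ B) (hd : d ∈ B)
    (hbd : b < d) (h : ∀ d' ∈ B, b < d' → d ≤ d') : b ∣ d := by
  have hn : nextBase B b = d := by
    apply le_antisymm
    · exact sInf_le ⟨d, ⟨hd, hbd⟩, rfl⟩
    · rw [nextBase, le_sInf_iff]
      rintro _ ⟨d', ⟨h1, h2⟩, rfl⟩
      exact Nat.cast_le.2 (h d' h1 h2)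
  obtain ⟨k, hk⟩ := hn ▸ hB.dvd_nextBase b hb
  have hb0 := hB.two_le b hb
  induction k using ENat.recTopCoe with
  | top => rw [ENat.mul_top (by exact_mod_cast (by omega : b ≠ 0))] at hk; simp at hk
  | coe k => exact ⟨k, by exact_mod_cast hk⟩

/-- Adding a number less than `c` to a multiple of `c` below the successor of `c` stays below this
successor. -/
theorem IsBaseHierarchy.add_lt_nextBase (hB : IsBaseHierarchy B) {c q a : ℕ} (hc : c ∈ B)
    (hq : c ∣ q) (hqc : (q : ℕ∞) < nextBase B c) (ha : a < c) :
    ((q + a : ℕ) : ℕ∞) < nextBase B c := by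
  rw [natCast_lt_nextBase_iff] at hqc ⊢
  intro d hd hcd
  have hne : {d | d ∈ B ∧ c < d}.Nonempty := ⟨d, hd, hcd⟩
  obtain ⟨h1, h2⟩ := Nat.sInf_mem hne
  have hle : ∀ d' ∈ B, c < d' → sInf {d | d ∈ B ∧ c < d} ≤ d' := fun d' h h' =>
    Nat.sInf_le ⟨h, h'⟩
  have hdvd := hB.dvd_of_succ hc h1 h2 hle
  have hlt := hqc _ h1 h2
  refine lt_of_lt_of_le ?_ (hle d hd hcd)
  obtain ⟨x, rfl⟩ := hq
  obtain ⟨y, hy⟩ := hdvd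
  rw [hy] at hlt ⊢
  calc c * x + a < c * (x + 1) := by rw [mul_add_one]; omega
    _ ≤ c * y := Nat.mul_le_mul_left _ (Nat.lt_of_mul_lt_mul_left hlt)

end BaseHierarchy

/-- `u` is the upgrade from the base hierarchy `B` to its good successor `C`, as a function on the
natural numbers. -/
structure IsUpgrade (B C : Set ℕ) (u : ℕ → ℕ) : Prop where
  source : IsBaseHierarchy B
  target : IsBaseHierarchy C
  good : IsGoodSuccessor B C
  upgrade_eq : ∀ n, upgrade B C n = (u n : ℕ∞)

namespace IsUpgrade

variable {B C : Set ℕ} {u : ℕ → ℕ}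

theorem eq_self (h : IsUpgrade B C u) {n : ℕ} (hn : n < sInf B) : u n = n := by
  have := h.upgrade_eq n
  rw [upgrade_of_lt B C hn] at this
  exact_mod_cast this.symm

theorem zero (h : IsUpgrade B C u) : u 0 = 0 :=
  h.eq_self (by have := h.source.two_le_sInf; omega)

theorem one (h : IsUpgrade B C u) : u 1 = 1 :=
  h.eq_self h.source.two_le_sInf

theorem two_le_baseAt (h : IsUpgrade B C u) {n : ℕ} (hn : sInf B ≤ n) : 2 ≤ baseAt B n :=
  h.source.two_le _ (baseAt_spec h.source.nonempty hn).1

theorem mem_witnesses_iff (h : IsUpgrade B C u) {n c : ℕ} (hn : sInf B ≤ n) :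
    c ∈ witnesses B C n ↔ c ∈ C ∧ u (n - 1) < natEval (baseAt B n) c u n ∧
      (natEval (baseAt B n) c u n : ℕ∞) < nextBase C c := by
  have : upgrade B C = fun a => (u a : ℕ∞) := funext h.upgrade_eq
  rw [witnesses, this]
  simp only [changeBase_coe (h.two_le_baseAt hn), Set.mem_ofPred_eq, Nat.cast_lt]

theorem exists_witness (h : IsUpgrade B C u) {n : ℕ} (hn : sInf B ≤ n) :
    ∃ c ∈ C, u n = natEval (baseAt B n) c u n ∧ u (n - 1) < u n ∧ (u n : ℕ∞) < nextBase C c ∧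
      ∀ d ∈ C, u (n - 1) < natEval (baseAt B n) d u n →
        (natEval (baseAt B n) d u n : ℕ∞) < nextBase C d → c ≤ d := by
  have heq := upgrade_of_le h.source C hn
  have hne : (witnesses B C n).Nonempty := by
    by_contra hne
    rw [if_neg hne, h.upgrade_eq] at heq
    simp at heq
  have hfun : upgrade B C = fun a => (u a : ℕ∞) := funext h.upgrade_eq
  rw [if_pos hne, h.upgrade_eq, hfun, changeBase_coe (h.two_le_baseAt hn), Nat.cast_inj] at heq
  obtain ⟨h1, h2, h3⟩ := (h.mem_witnesses_iff hn).1 (Nat.sInf_mem hne)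
  rw [← heq] at h2 h3
  exact ⟨_, h1, heq, h2, h3, fun d hd h4 h5 =>
    Nat.sInf_le ((h.mem_witnesses_iff hn).2 ⟨hd, h4, h5⟩)⟩

theorem strictMono (h : IsUpgrade B C u) : StrictMono u := by
  refine strictMono_nat_of_lt_succ fun n => ?_
  rcases lt_or_ge (n + 1) (sInf B) with hn | hn
  · rw [h.eq_self hn, h.eq_self (by omega)]
    exact n.lt_succ_self
  · obtain ⟨c, -, -, h1, -⟩ := h.exists_witness hn
    exact h1

/-- A base `b` is upgraded to the least base of the target above the upgrade of `b - 1`. -/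
theorem map_base (h : IsUpgrade B C u) {b : ℕ} (hb : b ∈ B) :
    u b ∈ C ∧ ∀ d ∈ C, u (b - 1) < d → u b ≤ d := by
  have hb2 := h.source.two_le b hb
  have hself : ∀ c, natEval b c u b = c := fun c => by
    have := natEval_pow_mul_add (c := c) (u := u) hb2 one_pos one_pos (show 1 < b by omega)
      (show 0 < b ^ 1 by simp; omega)
    rw [natEval_of_lt (show 0 < b by omega), natEval_of_lt (show 1 < b by omega), h.zero,
      h.one] at this
    simpa using this
  obtain ⟨c, hc, h1, h2, -, h4⟩ := h.exists_witness (Nat.sInf_le hb)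
  rw [baseAt_self hb] at h1 h4
  simp only [hself] at h1 h4
  rw [h1]
  exact ⟨hc, fun d hd hlt => h4 d hd hlt (natCast_lt_nextBase_iff.2 fun _ _ => id)⟩

/-- The base used for the upgrade of `n` is `baseAt C (u n)`. It is at least the upgrade of the base
of `n`, and the least element of the target with the defining property of the upgrade. -/
theorem eq_natEval (h : IsUpgrade B C u) {n : ℕ} (hn : sInf B ≤ n) :
    sInf C ≤ u n ∧ u (baseAt B n) ≤ baseAt C (u n) ∧
      u n = natEval (baseAt B n) (baseAt C (u n)) u n ∧
      (u n : ℕ∞) < nextBase C (baseAt C (u n)) ∧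
      ∀ d ∈ C, u (n - 1) < natEval (baseAt B n) d u n →
        (natEval (baseAt B n) d u n : ℕ∞) < nextBase C d → baseAt C (u n) ≤ d := by
  obtain ⟨hb, hbn, -⟩ := baseAt_spec h.source.nonempty hn
  have hb2 := h.two_le_baseAt hn
  obtain ⟨c, hc, h1, -, h3, h4⟩ := h.exists_witness hn
  have hbc := (h.map_base hb).1
  have hle : u (baseAt B n) ≤ c := by
    by_contra! hlt
    have := natCast_lt_nextBase_iff.1 h3 _ hbc hlt
    have := h.strictMono.monotone hbn
    omega
  have hcn : c ≤ u n := by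
    rw [h1]
    exact base_le_natEval hb2 (h.target.two_le c hc) h.strictMono
      (fun a ha => (h.strictMono ha).trans_le hle) hbn
  have hbase : baseAt C (u n) = c := by
    refine baseAt_eq hc hcn fun d hd hdn => ?_
    by_contra! hlt
    have := natCast_lt_nextBase_iff.1 h3 d hd hlt
    omega
  rw [hbase]
  exact ⟨sInf_le_of_mem_of_le hc hcn, hle, h1, h3, h4⟩

/-- If the base of `u n` is larger than a base `d ≥ u (baseAt B n)`, then `d` is skipped because the
base change of `n` to `d` reaches the next base `c'` after `d`: the other possible reason, that the
base change of `n` to `d` is at most `u (n - 1)`, already requires that `d` is skipped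
for `n - 1`. -/
theorem le_natEval_of_skip (h : IsUpgrade B C u) {d c' : ℕ} (hd : d ∈ C)
    (hsucc : ∀ d' ∈ C, d < d' → c' ≤ d') {n : ℕ} (hn : sInf B ≤ n) (hbd : u (baseAt B n) ≤ d)
    (hdc : d < c') (hc : c' ≤ baseAt C (u n)) : c' ≤ natEval (baseAt B n) d u n := by
  induction n with
  | zero => have := h.source.two_le_sInf; omega
  | succ n ih =>
    obtain ⟨hb, hbn, -⟩ := baseAt_spec h.source.nonempty hn
    have hb2 := h.two_le_baseAt hn
    have hmono := natEval_strictMono (c := d) hb2 h.strictMono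
      fun a ha => (h.strictMono ha).trans_le hbd
    by_contra! hlt
    obtain ⟨-, -, -, -, h5⟩ := h.eq_natEval hn
    have hle : natEval (baseAt B (n + 1)) d u (n + 1) ≤ u n := by
      by_contra! hlt'
      have := h5 d hd hlt' (natCast_lt_nextBase_iff.2 fun d' hd' hdd' => hlt.trans_le
        (hsucc d' hd' hdd'))
      omega
    rcases hbn.eq_or_lt with heq | hlt'
    · have h1 : baseAt C (u (n + 1)) = u (n + 1) := baseAt_self (heq ▸ (h.map_base hb).1)
      rw [heq] at hbd
      omega
    · have hn' : sInf B ≤ n := sInf_le_of_mem_of_le hb (by omega)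
      have hbase : baseAt B n = baseAt B (n + 1) :=
        baseAt_eq_of_le h.source.nonempty hn (by omega) (by omega)
      rw [hbase] at ih
      obtain ⟨g1, g2, g3, -⟩ := h.eq_natEval hn'
      rw [hbase] at g2 g3
      have hsm := hmono (Nat.lt_add_one n)
      rcases le_or_gt c' (baseAt C (u n)) with hcc | hcc
      · exact absurd (ih hn' hbd hcc) (by omega)
      · have hle' : baseAt C (u n) ≤ d := by
          by_contra! hgt
          have := hsucc _ (baseAt_spec h.target.nonempty g1).1 hgt
          omega
        have h0 : 0 < baseAt C (u n) := (Nat.zero_le _).trans_lt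
          ((h.strictMono (show 0 < baseAt B (n + 1) by omega)).trans_le g2)
        have := natEval_mono_base (u := u) hb2 h0 hle' n
        omega

/-- The upgrade of a multiple `q` of its base is a multiple of its base, and changing the last digit
of `q` changes the last digit of the upgrade. -/
theorem add_digit (h : IsUpgrade B C u) {q : ℕ} (hn : sInf B ≤ q) (hq : baseAt B q ∣ q) :
    baseAt C (u q) ∣ u q ∧ ∀ a < baseAt B q, u a < baseAt C (u q) ∧ u (q + a) = u q + u a := by
  obtain ⟨hb, hbq, hmax⟩ := baseAt_spec h.source.nonempty hn
  have hb2 := h.two_le_baseAt hn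
  obtain ⟨g1, g2, g3, g4, -⟩ := h.eq_natEval hn
  have hcC := (baseAt_spec h.target.nonempty g1).1
  have hlt : ∀ a < baseAt B q, u a < baseAt C (u q) := fun a ha => (h.strictMono ha).trans_le g2
  obtain ⟨e1, e2⟩ := natEval_add_digit hb2 h.strictMono h.zero hlt hq
  rw [← g3] at e1 e2
  refine ⟨e1, fun a ha => ⟨hlt a ha, ?_⟩⟩
  induction a with
  | zero => simp [h.zero]
  | succ a ih =>
    have iha := ih (by omega)
    have hbase : baseAt B (q + (a + 1)) = baseAt B q := by
      refine baseAt_eq hb (by omega) fun d hd hdn => ?_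
      by_contra! hbd
      refine absurd (natCast_lt_nextBase_iff.1 (h.source.add_lt_nextBase hb hq
        (natCast_lt_nextBase_iff.2 fun d hd hbd => ?_) ha) d hd hbd) (by omega)
      by_contra! hdq
      have := hmax d hd hdq
      omega
    obtain ⟨f1, f2, f3, f4, f5⟩ := h.eq_natEval (hn.trans (Nat.le_add_right q (a + 1)))
    rw [hbase] at f3 f5
    have e := e2 (a + 1) ha
    have hle := f5 _ hcC
      (by rw [e, Nat.add_sub_assoc (by omega), Nat.add_sub_cancel, iha]
          exact Nat.add_lt_add_left (h.strictMono (by omega)) _)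
      (by rw [e]; exact h.target.add_lt_nextBase hcC e1 g4 (hlt _ ha))
    have hge := baseAt_mono h.target.nonempty g1
      (h.strictMono.monotone (Nat.le_add_right q (a + 1)))
    rw [f3, le_antisymm hle hge, e]

end IsUpgrade
/-! ### Dynamical hierarchies -/

namespace DynamicalHierarchy

variable (H : DynamicalHierarchy)

theorem isUpgrade (i : ℕ) : IsUpgrade (H.base i) (H.base (i + 1)) (H.upgradeAt i) where
  source := H.isBaseHierarchy i
  target := H.isBaseHierarchy (i + 1)
  good := H.isGoodSuccessor i
  upgrade_eq _ := (ENat.natCast_lift _ _).symm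

/-- The pair `(i, n)` stands for the number `n` at step `i`, identified with the pair
`(i + 1, ↑n)`. `H.Below (j, y) (i, n)` says that `i ≤ j` and that `y` is less than the number
to which `n` is upgraded on the way from step `i` to step `j`. -/
inductive Below : ℕ × ℕ → ℕ × ℕ → Prop
  | of_lt {i y n : ℕ} : y < n → Below (i, y) (i, n)
  | of_upgrade {q : ℕ × ℕ} {i n : ℕ} : Below q (i + 1, H.upgradeAt i n) → Below q (i, n)

variable {H}

theorem acc_upgradeAt {i n : ℕ} (h : Acc H.Below (i, n)) :
    Acc H.Below (i + 1, H.upgradeAt i n) :=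
  Acc.intro _ fun _ hq => h.inv (.of_upgrade hq)

theorem acc_of_le {i m n : ℕ} (h : Acc H.Below (i, n)) (hmn : m ≤ n) : Acc H.Below (i, m) := by
  rcases hmn.eq_or_lt with rfl | hlt
  · exact h
  · exact h.inv (.of_lt hlt)

/-- Numbers below the least base are accessible, since they are never changed by an upgrade. -/
theorem acc_of_lt_sInf {i n : ℕ} (hn : n < sInf (H.base i)) : Acc H.Below (i, n) := by
  induction n using Nat.strong_induction_on generalizing i with
  | _ n ih =>
    refine Acc.intro _ fun q hq => ?_
    generalize hp : (i, n) = p at hq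
    induction hq generalizing i with
    | of_lt hlt => cases hp; exact ih _ hlt (hlt.trans hn)
    | @of_upgrade q i n _ ih' =>
      cases hp
      exact ih' (hn.trans_le (H.isGoodSuccessor i).min_le)
        (by rw [(H.isUpgrade i).eq_self hn])

/-- If a multiple `q` of its base and a last digit `a` are accessible, then so is `q + a`. This is
the well-foundedness of a sum of two well-orders. -/
theorem acc_add_digit {i q a : ℕ} (ha : Acc H.Below (i, a)) (hq : Acc H.Below (i, q))
    (hn : sInf (H.base i) ≤ q) (hdvd : baseAt (H.base i) q ∣ q) (hab : a < baseAt (H.base i) q) :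
    Acc H.Below (i, q + a) := by
  generalize hp : (i, a) = p at ha
  induction ha generalizing i q a with
  | intro p hacc ih =>
    subst hp
    clear hacc
    refine Acc.intro _ fun y hy => ?_
    generalize hp : (i, q + a) = p at hy
    induction hy generalizing i q a with
    | @of_lt i y n hlt =>
      cases hp
      rcases lt_or_ge y q with hyq | hyq
      · exact hq.inv (.of_lt hyq)
      · obtain ⟨a', rfl⟩ := Nat.exists_eq_add_of_le hyq
        exact ih (i, a') (.of_lt (by omega)) hq hn hdvd (by omega) rfl
    | @of_upgrade q i n _ ih' =>
      cases hp
      obtain ⟨h1, h2⟩ := (H.isUpgrade i).add_digit hn hdvd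
      obtain ⟨h3, h4⟩ := h2 a hab
      exact ih' (acc_upgradeAt hq) ((H.isUpgrade i).eq_natEval hn).1 h1 h3
        (fun y hy => ih y (.of_upgrade hy)) (by rw [h4])

/-- If `b - 1` is accessible for a base `b`, then so is `c - 1`, where `c` is the upgrade of `b`.
By the third condition on good successors, `c - 1` and the upgrade of `b - 1` differ in the last
digit only. -/
theorem acc_upgradeAt_base_sub_one {i b : ℕ} (hb : b ∈ H.base i) (h : Acc H.Below (i, b - 1)) :
    Acc H.Below (i + 1, H.upgradeAt i b - 1) := by
  have hu := H.isUpgrade i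
  obtain ⟨hc, hmin⟩ := hu.map_base hb
  have hb2 := hu.source.two_le b hb
  have hc2 := hu.target.two_le _ hc
  rcases (Nat.sInf_le hb).eq_or_lt with rfl | hlt
  · have hC := Nat.sInf_mem hu.target.nonempty
    have := hu.good.min_le
    have := hmin _ hC (by rw [hu.eq_self (by omega)]; omega)
    exact acc_of_lt_sInf (by omega)
  · have hxc := hu.strictMono (show b - 1 < b by omega)
    have hx : sInf (H.base (i + 1)) ≤ H.upgradeAt i (b - 1) :=
      sInf_le_of_mem_of_le (hu.map_base (Nat.sInf_mem hu.source.nonempty)).1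
        (hu.strictMono.monotone (by omega))
    have hno := hu.good.no_multiple b hb hlt _ (hu.upgrade_eq _)
    have hacc := acc_upgradeAt h
    generalize H.upgradeAt i b = c at *
    generalize H.upgradeAt i (b - 1) = x at *
    obtain ⟨hd, hdx, hdmax⟩ := baseAt_spec hu.target.nonempty hx
    have hd2 := hu.target.two_le _ hd
    have hdvd : baseAt (H.base (i + 1)) x ∣ c := by
      refine hu.target.dvd_of_succ hd hc (by omega) fun d' hd' hlt' => hmin d' hd' ?_
      by_contra! hle
      have := hdmax d' hd' hle
      omega
    generalize hdd : baseAt (H.base (i + 1)) x = d at *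
    -- `c - d` is the largest multiple of `d` below `c`
    have hdq : d ∣ c - d := Nat.dvd_sub hdvd dvd_rfl
    have hcd : d ≤ c - d := Nat.le_of_dvd (by omega) hdq
    have hqx : c - d ≤ x := by
      by_contra! hgt
      refine hno ⟨c - d, hdq, hgt, natCast_lt_nextBase_iff.2 fun d' hd' hlt' => ?_⟩
      have := hmin d' hd' hlt'
      omega
    have hbase : baseAt (H.base (i + 1)) (c - d) = d :=
      baseAt_eq hd hcd fun d' hd' hle => hdmax d' hd' (hle.trans hqx)
    have := acc_add_digit (a := d - 1) (acc_of_le hacc (by omega)) (acc_of_le hacc hqx)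
      (sInf_le_of_mem_of_le hd hcd) (by rw [hbase]; exact hdq) (by rw [hbase]; omega)
    rwa [show c - d + (d - 1) = c - 1 by omega] at this

/-! ### Ordinals of accessible numbers -/

variable (H) in
open Classical in
/-- The rank of an accessible pair, and `0` for other pairs. -/
noncomputable def accRank (p : ℕ × ℕ) : Ordinal.{0} :=
  if h : Acc H.Below p then h.rank else 0

variable (H) in
/-- An ordinal above the ranks of all accessible pairs. -/
noncomputable def rankBound : Ordinal.{0} :=
  Order.succ (⨆ p : ℕ × ℕ, H.accRank p)

variable (H) in
/-- The ordinal `[b → Ω] n`, where `b` is the base of `n` at step `i` and `Ω` exceeds all ranks;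
the coefficients are replaced by their ranks. -/
noncomputable def shape (i n : ℕ) : Ordinal.{0} :=
  ordEval (baseAt (H.base i) n) H.rankBound (fun a => H.accRank (i, a)) n

theorem accRank_lt_rankBound (p : ℕ × ℕ) : H.accRank p < H.rankBound :=
  Order.lt_succ_of_le (Ordinal.le_iSup _ p)

theorem accRank_lt_accRank {i m n : ℕ} (h : Acc H.Below (i, n)) (hmn : m < n) :
    H.accRank (i, m) < H.accRank (i, n) := by
  rw [accRank, accRank, dif_pos h, dif_pos (acc_of_le h hmn.le)]
  exact h.rank_lt_of_rel (.of_lt hmn)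

theorem accRank_upgradeAt_le {i n : ℕ} (h : Acc H.Below (i, n)) :
    H.accRank (i + 1, H.upgradeAt i n) ≤ H.accRank (i, n) := by
  rw [accRank, accRank, dif_pos h, dif_pos (acc_upgradeAt h), Acc.rank_eq]
  exact Ordinal.iSup_le fun q => Order.succ_le_of_lt (h.rank_lt_of_rel (.of_upgrade q.2))

theorem ordEval_accRank_strictMono {i b : ℕ} (hb : 2 ≤ b) (h : Acc H.Below (i, b - 1)) :
    StrictMono (ordEval b H.rankBound fun a => H.accRank (i, a)) :=
  ordEval_strictMono hb (fun _ _ h1 h2 => accRank_lt_accRank (acc_of_le h (by omega)) h1)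
    fun _ _ => accRank_lt_rankBound _

/-- Base changes with upgraded coefficients do not increase the associated ordinals. -/
theorem ordEval_accRank_natEval_le {i b c : ℕ} (hb : 2 ≤ b) (hc : 2 ≤ c)
    (hbc : ∀ a < b, H.upgradeAt i a < c) (h : Acc H.Below (i, b - 1)) (n : ℕ) :
    ordEval c H.rankBound (fun a => H.accRank (i + 1, a)) (natEval b c (H.upgradeAt i) n) ≤
      ordEval b H.rankBound (fun a => H.accRank (i, a)) n := by
  rw [ordEval_natEval hb hc (H.isUpgrade i).strictMono hbc]
  exact ordEval_mono hb (zero_le.trans_lt (accRank_lt_rankBound (0, 0))) le_rfl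
    (fun a ha => accRank_upgradeAt_le (acc_of_le h (by omega))) n

theorem shape_upgradeAt_le {i n : ℕ} (hn : sInf (H.base i) ≤ n)
    (h : Acc H.Below (i, baseAt (H.base i) n - 1)) :
    H.shape (i + 1) (H.upgradeAt i n) ≤ H.shape i n := by
  have hu := H.isUpgrade i
  obtain ⟨h1, h2, h3, -⟩ := hu.eq_natEval hn
  have hc2 := hu.target.two_le _ (baseAt_spec hu.target.nonempty h1).1
  have := ordEval_accRank_natEval_le (hu.two_le_baseAt hn) hc2
    (fun a ha => (hu.strictMono ha).trans_le h2) h n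
  rwa [← h3] at this

/-! ### All numbers are accessible -/

/-- Accessibility of `b - 1`, for `b` the base of `n`, is preserved when `n` is upgraded, provided
that numbers of smaller shape have been dealt with. The base of the upgrade may exceed the upgrade
of `b`; but then the predecessors of the bases in between have a smaller shape than `n`. -/
theorem acc_baseAt_upgradeAt_sub_one {i n : ℕ} (hn : sInf (H.base i) ≤ n)
    (h : Acc H.Below (i, baseAt (H.base i) n - 1))
    (ih : ∀ m, sInf (H.base (i + 1)) ≤ m → Acc H.Below (i + 1, baseAt (H.base (i + 1)) m - 1) →
      H.shape (i + 1) m < H.shape i n → Acc H.Below (i + 1, m)) :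
    Acc H.Below (i + 1, baseAt (H.base (i + 1)) (H.upgradeAt i n) - 1) := by
  have hu := H.isUpgrade i
  obtain ⟨hb, -, -⟩ := baseAt_spec hu.source.nonempty hn
  have hb2 := hu.two_le_baseAt hn
  obtain ⟨h1, h2, -⟩ := hu.eq_natEval hn
  suffices key : ∀ c ∈ H.base (i + 1), H.upgradeAt i (baseAt (H.base i) n) ≤ c →
      c ≤ baseAt (H.base (i + 1)) (H.upgradeAt i n) → Acc H.Below (i + 1, c - 1) from
    key _ (baseAt_spec hu.target.nonempty h1).1 h2 le_rfl
  intro c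
  induction c using Nat.strong_induction_on with
  | _ c ihc =>
    intro hc hbc hcn
    rcases hbc.eq_or_lt with rfl | hlt
    · exact acc_upgradeAt_base_sub_one hb h
    · have hubC := (hu.map_base hb).1
      have hmin : sInf (H.base (i + 1)) ≤ c - 1 := sInf_le_of_mem_of_le hubC (by omega)
      obtain ⟨hd, hdc, hdmax⟩ := baseAt_spec hu.target.nonempty hmin
      have hbd := hdmax _ hubC (by omega)
      have hd2 := hu.target.two_le _ hd
      have hdlt : ∀ a < baseAt (H.base i) n,
          H.upgradeAt i a < baseAt (H.base (i + 1)) (c - 1) :=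
        fun a ha => (hu.strictMono ha).trans_le hbd
      have hacc := ihc _ (by omega) hd hbd (by omega)
      refine ih _ hmin hacc ?_
      have hle := hu.le_natEval_of_skip hd (fun d' hd' hlt' => by
        by_contra! hgt
        have := hdmax d' hd' (by omega)
        omega) hn hbd (by omega) hcn
      exact (ordEval_accRank_strictMono hd2 hacc (by omega)).trans_le
        (ordEval_accRank_natEval_le hb2 hd2 hdlt h n)

/-- If `b` is the base of `n` and `b - 1` is accessible, then so is `n`. -/
theorem acc_of_acc_baseAt_sub_one {i n : ℕ} (hn : sInf (H.base i) ≤ n)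
    (h : Acc H.Below (i, baseAt (H.base i) n - 1)) : Acc H.Below (i, n) := by
  suffices key : ∀ σ i n, sInf (H.base i) ≤ n → Acc H.Below (i, baseAt (H.base i) n - 1) →
      H.shape i n ≤ σ → Acc H.Below (i, n) from key _ i n hn h le_rfl
  clear hn h i n
  intro σ
  induction σ using WellFoundedLT.induction with
  | _ σ ih =>
    intro i n hn h hσ
    refine Acc.intro _ fun q hq => ?_
    generalize hp : (i, n) = p at hq
    induction hq generalizing i n with
    | @of_lt i y n hlt =>
      cases hp
      rcases lt_or_ge y (baseAt (H.base i) n) with hy | hy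
      · exact acc_of_le h (by omega)
      · -- `y` and `n` have the same base, so the shape of `y` is the smaller one
        have hne := (H.isBaseHierarchy i).nonempty
        have hb := (baseAt_spec hne hn).1
        have hyb := baseAt_eq_of_le hne hn hy hlt.le
        have hs : H.shape i y < H.shape i n := by
          rw [shape, shape, hyb]
          exact ordEval_accRank_strictMono ((H.isBaseHierarchy i).two_le _ hb) h hlt
        exact ih _ (hs.trans_le hσ) i y (sInf_le_of_mem_of_le hb hy) (by rwa [hyb]) le_rfl
    | @of_upgrade q i n _ ih' =>
      cases hp
      exact ih' _ _ ((H.isUpgrade i).eq_natEval hn).1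
        (acc_baseAt_upgradeAt_sub_one hn h fun m hm hm' hs =>
          ih _ (hs.trans_le hσ) _ m hm hm' le_rfl)
        ((shape_upgradeAt_le hn h).trans hσ) rfl

theorem acc (i n : ℕ) : Acc H.Below (i, n) := by
  induction n using Nat.strong_induction_on with
  | _ n ih =>
    rcases lt_or_ge n (sInf (H.base i)) with hn | hn
    · exact acc_of_lt_sInf hn
    · have h1 := (baseAt_spec (H.isBaseHierarchy i).nonempty hn).2.1
      have h2 := (H.isUpgrade i).two_le_baseAt hn
      exact acc_of_acc_baseAt_sub_one hn (ih _ (by omega))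

end DynamicalHierarchy

end FractalGoodstein

theorem mainTheorem1 (H : FractalGoodstein.DynamicalHierarchy) (m : ℕ) :
    ∃ i : ℕ, FractalGoodstein.goodstein H m i = 0 := by
  suffices key : ∀ p, Acc H.Below p → ∀ i, p = (i, FractalGoodstein.goodstein H m i) →
      ∃ i, FractalGoodstein.goodstein H m i = 0 from
    key _ (FractalGoodstein.DynamicalHierarchy.acc 0 m) 0 rfl
  intro p hp
  induction hp with
  | intro p _ ih =>
    rintro i rfl
    rcases Nat.eq_zero_or_pos (FractalGoodstein.goodstein H m i) with h0 | hpos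
    · exact ⟨i, h0⟩
    · refine ih _ (.of_upgrade (.of_lt ?_)) (i + 1) rfl
      have := (H.isUpgrade i).strictMono.le_apply (x := FractalGoodstein.goodstein H m i)
      rw [FractalGoodstein.goodstein, if_pos hpos]
      omega
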